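/- Let $(R,\mathfrak m,k)$ be a commutative Noetherian local ring, and let $x,y\in\mathfrak m$ be a pair of exact zerodivisors, that is, $(0:x)=(y)$ and $(0:y)=(x)$. A finitely generated module $M$ over a commutative Noetherian ring $A$ is called totally reflexive if the natural map $M\to M^{**}$ is an isomorphism and $\operatorname{Ext}^i_A(M,A)=0=\operatorname{Ext}^i_A(M^*,A)$ for all $i>0$, where $(-)^*=\operatorname{Hom}_A(-,A)$; the ring $A$ is G-regular if every totally reflexive $A$-module is free. Let $s(x,y)\in\{0,1,2,\dots,\infty\}$ be the supremum, over all ideals $J$ of $R$, of the minimal number of generators of the ideal $J(R/(x,y))$ of $R/(x,y)$. Assume that $R/(x)$ is G-regular and that there is a proper ideal $I$ of $R$ with $\operatorname{ht}(I(R/(x,y)))\ge 2$. Then $s(x,y)=\infty$, and the following hold. 1. For every integer $r\ge0$ there is an exact sequence of $R$-modules $0\to(R/(x))^r\to M\to R/(y)\to0$ with $M$ indecomposable. 2. For every integer $r\ge1$ there is a family of exact sequences of $R$-modules $\{0\to(R/(x))^r\to M_a\to R/(y)\to0\}_{a\in R}$ such that each $M_a$ is indecomposable and such that, for $p,q\in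 R$, if $M_p\cong M_q$ then $\overline p=\overline q$ in $k=R/\mathfrak m$. -/

import Mathlib

universe u

/-- `{x, y}` is a pair of exact zerodivisors of the local ring `R`: both elements lie in the maximal
ideal, `(0 : x) = (y)` and `(0 : y) = (x)`. -/
structure IsExactZerodivisorPair {R : Type u} [CommRing R] [IsLocalRing R] (x y : R) : Prop where
  left_mem : x ∈ IsLocalRing.maximalIdeal R
  right_mem : y ∈ IsLocalRing.maximalIdeal R
  ann_left : ∀ r : R, r * x = 0 ↔ r ∈ Ideal.span {y}
  ann_right : ∀ r : R, r * y = 0 ↔ r ∈ Ideal.span {x}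

/-- A totally reflexive `R`-module: a finitely generated module `M` such that the natural map
`M → M**` is an isomorphism and `Ext^i_R(M, R) = 0 = Ext^i_R(M*, R)` for all `i > 0`. -/
structure IsTotallyReflexive (R : Type u) [CommRing R] (M : Type u) [AddCommGroup M] [Module R M] :
    Prop where
  finite : Module.Finite R M
  reflexive : Function.Bijective (Module.Dual.eval R M)
  ext_eq_zero : ∀ i : ℕ, 0 < i →
    Subsingleton (CategoryTheory.Abelian.Ext (ModuleCat.of R M) (ModuleCat.of R R) i)
  ext_dual_eq_zero : ∀ i : ℕ, 0 < i →
    Subsingleton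
      (CategoryTheory.Abelian.Ext (ModuleCat.of R (Module.Dual R M)) (ModuleCat.of R R) i)

/-- A ring is G-regular if all totally reflexive modules over it are free. -/
def IsGRegular (R : Type u) [CommRing R] : Prop :=
  ∀ (M : Type u) [AddCommGroup M] [Module R M], IsTotallyReflexive R M → Module.Free R M

/-- The invariant `s(x, y)`: the supremum of the minimal numbers of generators
`ν_{R/(x,y)}(I (R/(x,y)))`, where `I` runs through the ideals of the Noetherian ring `R`. -/
noncomputable def exactPairRank {R : Type u} [CommRing R] [IsNoetherianRing R] (x y : R) : ℕ∞ :=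
  ⨆ I : Ideal R,
    ((I.map (Ideal.Quotient.mk (Ideal.span {x, y}))).spanFinrank : ℕ∞)

/-- There is an exact sequence `0 → (R/(x))^r → M → R/(y) → 0` of `R`-modules. -/
def IsExtensionModule {R : Type u} [CommRing R] (x y : R) (r : ℕ) (M : ModuleCat.{u} R) : Prop :=
  ∃ (f : (Fin r → R ⧸ Ideal.span {x}) →ₗ[R] M) (g : M →ₗ[R] R ⧸ Ideal.span {y}),
    Function.Injective f ∧ Function.Exact f g ∧ Function.Surjective g

/-! Let `M_b` be the quotient of `(R/(x))^r × R` by the single relation `(b, y)`, an extension of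
`R/(y)` by `(R/(x))^r`. Both ends have 2-periodic resolutions and are totally reflexive, hence so is
`M_b`, and so are its direct summands. If `M_b = Y × Z`, locality of `R/(y)` makes one summand, say
`Y`, contain an element mapping to a unit. Then `(R/(x))^r` surjects onto `Z`, so `x` kills `Z`.
Since `Hom_R(R/(x), R) ≅ R/(x)`, total reflexivity of `Z` passes from `R` to `R/(x)`, and
G-regularity makes `Z` free. If `Z` is nonzero, a coordinate of `Z` gives a map `M_b → R/(x)` taking
the value 1 on `(R/(x))^r`. That is impossible when every relation among the `b i` modulo `(x, y)`
has coefficients in the maximal ideal (`ExtensionModule.indecomposable`). Arbitrarily long such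
tuples `b` exist because `R/(x, y)` has a quotient domain of dimension at least two, where the
powers of the maximal ideal need unboundedly many generators
(`exists_lt_spanFinrank_pow_maximalIdeal`); this also gives `s(x, y) = ∞`. For the families, replace
the last entry of `b` by `b_k + p b_{k+1}`. The ideal `(x, y, b)` is an isomorphism invariant of
`M_b` (`ExtensionModule.mem_of_linearEquiv`), and it remembers the residue of `p`. -/

/-! ### Vanishing of Ext into the ring along short exact sequences -/

section ExtVanishing

open CategoryTheory CategoryTheory.Abelian

variable {A : Type u} [CommRing A]

/-- `Ext^i_A(N, A) = 0` for all `i > 0`. -/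
def ExtVanishes (A : Type u) [CommRing A] (N : Type u) [AddCommGroup N] [Module A N] : Prop :=
  ∀ i : ℕ, 0 < i → Subsingleton (Ext (ModuleCat.of A N) (ModuleCat.of A A) i)

variable {L P N : Type u} [AddCommGroup L] [Module A L] [AddCommGroup P] [Module A P]
  [AddCommGroup N] [Module A N]

theorem shortExact_of_exact {f : L →ₗ[A] P} {g : P →ₗ[A] N} (hf : Function.Injective f)
    (h : Function.Exact f g) (hg : Function.Surjective g) :
    (ShortComplex.mk (ModuleCat.ofHom f) (ModuleCat.ofHom g)
      (by rw [← ModuleCat.ofHom_comp, h.linearMap_comp_eq_zero]; rfl)).ShortExact where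
  exact := (ShortComplex.ShortExact.moduleCat_exact_iff_function_exact _).2 h
  mono_f := (ModuleCat.mono_iff_injective _).2 hf
  epi_g := (ModuleCat.epi_iff_surjective _).2 hg

theorem subsingleton_ext_middle {f : L →ₗ[A] P} {g : P →ₗ[A] N} (hf : Function.Injective f)
    (h : Function.Exact f g) (hg : Function.Surjective g) {Y : ModuleCat.{u} A} {i : ℕ}
    (hL : Subsingleton (Ext (ModuleCat.of A L) Y i))
    (hN : Subsingleton (Ext (ModuleCat.of A N) Y i)) :
    Subsingleton (Ext (ModuleCat.of A P) Y i) := by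
  refine subsingleton_of_forall_eq 0 fun e => ?_
  obtain ⟨e', rfl⟩ := Ext.contravariant_sequence_exact₂ (shortExact_of_exact hf h hg) Y e
    (hL.elim _ _)
  rw [hN.elim e' 0, Ext.comp_zero]

theorem subsingleton_ext_left {f : L →ₗ[A] P} {g : P →ₗ[A] N} (hf : Function.Injective f)
    (h : Function.Exact f g) (hg : Function.Surjective g) {Y : ModuleCat.{u} A} {i : ℕ}
    (hP : Subsingleton (Ext (ModuleCat.of A P) Y i))
    (hN : Subsingleton (Ext (ModuleCat.of A N) Y (1 + i))) :
    Subsingleton (Ext (ModuleCat.of A L) Y i) := by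
  refine subsingleton_of_forall_eq 0 fun e => ?_
  obtain ⟨e', rfl⟩ := Ext.contravariant_sequence_exact₁ (shortExact_of_exact hf h hg) Y e rfl
    (hN.elim _ _)
  rw [hP.elim e' 0, Ext.comp_zero]

theorem subsingleton_ext_right {f : L →ₗ[A] P} {g : P →ₗ[A] N} (hf : Function.Injective f)
    (h : Function.Exact f g) (hg : Function.Surjective g) {Y : ModuleCat.{u} A} {i : ℕ}
    (hL : Subsingleton (Ext (ModuleCat.of A L) Y i))
    (hP : Subsingleton (Ext (ModuleCat.of A P) Y (1 + i))) :
    Subsingleton (Ext (ModuleCat.of A N) Y (1 + i)) := by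
  refine subsingleton_of_forall_eq 0 fun e => ?_
  obtain ⟨e', rfl⟩ := Ext.contravariant_sequence_exact₃ (shortExact_of_exact hf h hg) Y e
    (hP.elim _ _) rfl
  rw [hL.elim e' 0, Ext.comp_zero]

/-- The connecting map `Hom(L, A) → Ext¹(N, A)` is onto because `Ext¹(P, A) = 0`, and it kills every
map that extends to `P`. Together with the converse below, this trades `Ext¹` for concrete extension
problems, which transfer easily between `R` and `R/(x)`. -/
theorem subsingleton_ext_one_of_extend {f : L →ₗ[A] P} {g : P →ₗ[A] N}
    (hf : Function.Injective f) (h : Function.Exact f g) (hg : Function.Surjective g)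
    (hP : Subsingleton (Ext (ModuleCat.of A P) (ModuleCat.of A A) 1))
    (H : ∀ φ : L →ₗ[A] A, ∃ ψ : P →ₗ[A] A, ψ ∘ₗ f = φ) :
    Subsingleton (Ext (ModuleCat.of A N) (ModuleCat.of A A) 1) := by
  refine subsingleton_of_forall_eq 0 fun e => ?_
  have hS := shortExact_of_exact hf h hg
  obtain ⟨e', rfl⟩ := Ext.contravariant_sequence_exact₃ hS _ e (hP.elim _ _) (n₀ := 0) rfl
  obtain ⟨φ, rfl⟩ := Ext.addEquiv₀.symm.surjective e'
  obtain ⟨ψ, hψ⟩ := H φ.hom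
  have hφ : φ = ModuleCat.ofHom f ≫ ModuleCat.ofHom ψ := ModuleCat.hom_ext hψ.symm
  have : Ext.addEquiv₀.symm φ = (Ext.mk₀ (ModuleCat.ofHom f)).comp
      (Ext.mk₀ (ModuleCat.ofHom ψ)) (zero_add 0) := by
    rw [Ext.mk₀_comp_mk₀, ← hφ]; rfl
  rw [this]
  exact hS.extClass_comp_assoc _

theorem exists_extend_of_subsingleton_ext {f : L →ₗ[A] P} {g : P →ₗ[A] N}
    (hf : Function.Injective f) (h : Function.Exact f g) (hg : Function.Surjective g)
    (hN : Subsingleton (Ext (ModuleCat.of A N) (ModuleCat.of A A) 1)) (φ : L →ₗ[A] A) :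
    ∃ ψ : P →ₗ[A] A, ψ ∘ₗ f = φ := by
  obtain ⟨e, he⟩ := Ext.contravariant_sequence_exact₁ (shortExact_of_exact hf h hg) _
    (Ext.mk₀ (ModuleCat.ofHom φ)) rfl (hN.elim _ _)
  obtain ⟨ψ, rfl⟩ := Ext.addEquiv₀.symm.surjective e
  have : Ext.mk₀ (ModuleCat.ofHom f ≫ ψ) = Ext.mk₀ (ModuleCat.ofHom φ) := by
    rw [← he, ← Ext.mk₀_comp_mk₀]; rfl
  have := (Ext.mk₀_bijective _ _).1 this
  exact ⟨ψ.hom, by simpa using congrArg ModuleCat.Hom.hom this⟩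

theorem subsingleton_ext_of_retract (i : N →ₗ[A] P) (p : P →ₗ[A] N) (h : p ∘ₗ i = .id)
    {Y : ModuleCat.{u} A} {n : ℕ} (hP : Subsingleton (Ext (ModuleCat.of A P) Y n)) :
    Subsingleton (Ext (ModuleCat.of A N) Y n) := by
  refine subsingleton_of_forall_eq 0 fun e => ?_
  rw [← Ext.mk₀_id_comp e, ← ModuleCat.ofHom_id, ← h, ModuleCat.ofHom_comp,
    ← Ext.mk₀_comp_mk₀_assoc, hP.elim ((Ext.mk₀ (ModuleCat.ofHom p)).comp e _) 0, Ext.comp_zero]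

theorem ExtVanishes.retract (hP : ExtVanishes A P) (i : N →ₗ[A] P) (p : P →ₗ[A] N)
    (h : p ∘ₗ i = .id) : ExtVanishes A N :=
  fun n hn => subsingleton_ext_of_retract i p h (hP n hn)

theorem ExtVanishes.equiv (hP : ExtVanishes A P) (e : N ≃ₗ[A] P) : ExtVanishes A N :=
  hP.retract e e.symm (by ext; simp)

theorem ExtVanishes.of_projective [Module.Projective A P] : ExtVanishes A P := by
  intro i hi
  obtain ⟨j, rfl⟩ := Nat.exists_eq_add_of_lt hi
  have : Projective (ModuleCat.of A P) := (IsProjective.iff_projective _).1 inferInstance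
  rw [zero_add]
  exact Ext.subsingleton_of_projective _ _ _

theorem ExtVanishes.middle {f : L →ₗ[A] P} {g : P →ₗ[A] N} (hf : Function.Injective f)
    (h : Function.Exact f g) (hg : Function.Surjective g)
    (hL : ExtVanishes A L) (hN : ExtVanishes A N) : ExtVanishes A P :=
  fun i hi => subsingleton_ext_middle hf h hg (hL i hi) (hN i hi)

theorem ExtVanishes.left {f : L →ₗ[A] P} {g : P →ₗ[A] N} (hf : Function.Injective f)
    (h : Function.Exact f g) (hg : Function.Surjective g)
    (hP : ExtVanishes A P) (hN : ExtVanishes A N) : ExtVanishes A L :=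
  fun i hi => subsingleton_ext_left hf h hg (hP i hi) (hN (1 + i) (by omega))

end ExtVanishing

/-! ### Totally reflexive modules: retracts, extensions, finite powers -/

namespace IsTotallyReflexive

variable {A : Type u} [CommRing A]
variable {L P N : Type u} [AddCommGroup L] [Module A L] [AddCommGroup P] [Module A P]
  [AddCommGroup N] [Module A N]

theorem retract (hP : IsTotallyReflexive A P) (i : N →ₗ[A] P) (p : P →ₗ[A] N)
    (h : p ∘ₗ i = .id) : IsTotallyReflexive A N where
  finite := by
    have := hP.finite
    exact Module.Finite.of_surjective p fun n => ⟨i n, LinearMap.congr_fun h n⟩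
  reflexive := by
    have : Module.IsReflexive A P := ⟨hP.reflexive⟩
    exact (Module.IsReflexive.of_split i p h).bijective_dual_eval'
  ext_eq_zero := ExtVanishes.retract hP.ext_eq_zero i p h
  ext_dual_eq_zero := ExtVanishes.retract hP.ext_dual_eq_zero p.dualMap i.dualMap (by
    ext φ n
    exact congrArg φ (LinearMap.congr_fun h n))

/-- Since `Ext¹(N, A) = 0`, the dual sequence is again short exact; this gives the Ext conditions on
the dual, and biduality for `P` follows by a five-lemma chase. -/
theorem of_shortExact {f : L →ₗ[A] P} {g : P →ₗ[A] N} (hf : Function.Injective f)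
    (h : Function.Exact f g) (hg : Function.Surjective g)
    (hL : IsTotallyReflexive A L) (hN : IsTotallyReflexive A N) : IsTotallyReflexive A P := by
  have hgf : ∀ l, g (f l) = 0 := fun l => (h _).2 ⟨l, rfl⟩
  have hfd : Function.Surjective f.dualMap := fun φ =>
    exists_extend_of_subsingleton_ext hf h hg (hN.ext_eq_zero 1 one_pos) φ
  have hgd : Function.Injective g.dualMap := LinearMap.dualMap_injective_of_surjective hg
  have hfg : Function.Exact g.dualMap f.dualMap := by
    intro ψ
    constructor
    · intro hψ
      have hk : LinearMap.ker g ≤ LinearMap.ker ψ := by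
        intro p hp
        obtain ⟨l, rfl⟩ := (h p).1 hp
        exact LinearMap.congr_fun hψ l
      refine ⟨(LinearMap.ker g).liftQ ψ hk ∘ₗ (g.quotKerEquivOfSurjective hg).symm, ?_⟩
      ext p
      have : (g.quotKerEquivOfSurjective hg).symm (g p) = Submodule.Quotient.mk p := by
        rw [LinearEquiv.symm_apply_eq]; rfl
      simp [this]
    · rintro ⟨χ, rfl⟩
      ext l
      simp [hgf]
  refine ⟨?_, ⟨?_, ?_⟩, ExtVanishes.middle hf h hg hL.ext_eq_zero hN.ext_eq_zero,
    ExtVanishes.middle hgd hfg hfd hN.ext_dual_eq_zero hL.ext_dual_eq_zero⟩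
  · have := hL.finite
    have := hN.finite
    exact Module.Finite.of_exact h hg
  · rw [injective_iff_map_eq_zero]
    intro p hp
    have hp' : ∀ ψ : P →ₗ[A] A, ψ p = 0 := fun ψ => LinearMap.congr_fun hp ψ
    have : g p = 0 := hN.reflexive.1 (by ext χ; simpa using hp' (χ ∘ₗ g))
    obtain ⟨l, rfl⟩ := (h p).1 this
    have : l = 0 := by
      refine hL.reflexive.1 ?_
      ext φ
      obtain ⟨ψ, rfl⟩ := hfd φ
      simpa using hp' ψ
    rw [this, map_zero]
  · intro Θ
    obtain ⟨n, hn⟩ := hN.reflexive.2 (Θ ∘ₗ g.dualMap)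
    obtain ⟨p, rfl⟩ := hg n
    -- After subtracting evaluation at `p`, the functional vanishes on the image of `N*`, so it
    -- descends to `L*`, where it is evaluation at some `l`.
    have hker : LinearMap.ker f.dualMap ≤ LinearMap.ker (Θ - Module.Dual.eval A P p) := by
      intro ψ hψ
      obtain ⟨χ, rfl⟩ := (hfg ψ).1 hψ
      have := LinearMap.congr_fun hn χ
      simp at this
      simp [this]
    obtain ⟨l, hl⟩ := hL.reflexive.2 ((LinearMap.ker f.dualMap).liftQ _ hker ∘ₗ
      (f.dualMap.quotKerEquivOfSurjective hfd).symm)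
    refine ⟨p + f l, ?_⟩
    ext ψ
    have h1 := LinearMap.congr_fun hl (f.dualMap ψ)
    have h2 : (f.dualMap.quotKerEquivOfSurjective hfd).symm (f.dualMap ψ) =
        Submodule.Quotient.mk ψ := by
      rw [LinearEquiv.symm_apply_eq]; rfl
    rw [LinearMap.comp_apply, LinearEquiv.coe_coe, h2] at h1
    simp at h1
    simp [h1]

theorem of_subsingleton [Subsingleton N] : IsTotallyReflexive A N := by
  have : Subsingleton (Module.Dual A N) := ⟨fun f g => by ext n; simp [Subsingleton.elim n 0]⟩
  exact ⟨inferInstance, (inferInstance : Module.IsReflexive A N).bijective_dual_eval',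
    ExtVanishes.of_projective, ExtVanishes.of_projective⟩

theorem pi (hN : IsTotallyReflexive A N) : ∀ r : ℕ, IsTotallyReflexive A (Fin r → N)
  | 0 => of_subsingleton
  | r + 1 => by
    refine of_shortExact (f := LinearMap.single A (fun _ : Fin (r + 1) => N) 0)
      (g := LinearMap.funLeft A N Fin.succ) ?_ ?_ ?_ hN (pi hN r)
    · exact fun a b hab => by simpa using congrFun hab 0
    · intro v
      constructor
      · intro hv
        refine ⟨v 0, ?_⟩
        ext i
        refine Fin.cases (by simp) (fun j => ?_) i
        have := congrFun hv j
        simp [LinearMap.funLeft] at this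
        simp [this]
      · rintro ⟨n, rfl⟩
        ext j
        simp [LinearMap.funLeft]
    · exact LinearMap.funLeft_surjective_of_injective _ _ _ (Fin.succ_injective _)

end IsTotallyReflexive

/-! ### Exact zerodivisors: total reflexivity of `R/(x)` and change of rings -/

namespace IsExactZerodivisorPair

open CategoryTheory CategoryTheory.Abelian

variable {R : Type u} [CommRing R] [IsLocalRing R] {x y : R}

theorem symm (h : IsExactZerodivisorPair x y) : IsExactZerodivisorPair y x :=
  ⟨h.right_mem, h.left_mem, h.ann_right, h.ann_left⟩

theorem mul_eq_zero (h : IsExactZerodivisorPair x y) : x * y = 0 :=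
  (h.ann_right x).2 (Ideal.mem_span_singleton_self x)

/-- Multiplication by `y` as an embedding of `R/(x)` into `R`, with image `(y) = (0 : x)`. -/
def embedding (h : IsExactZerodivisorPair x y) : (R ⧸ Ideal.span {x}) →ₗ[R] R :=
  Submodule.liftQ _ (LinearMap.mulRight R y) fun r hr => (h.ann_right r).2 hr

@[simp]
theorem embedding_mk (h : IsExactZerodivisorPair x y) (r : R) :
    h.embedding (Ideal.Quotient.mk _ r) = r * y := rfl

theorem embedding_injective (h : IsExactZerodivisorPair x y) :
    Function.Injective h.embedding := by
  rw [injective_iff_map_eq_zero]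
  intro s hs
  obtain ⟨r, rfl⟩ := Ideal.Quotient.mk_surjective s
  exact Ideal.Quotient.eq_zero_iff_mem.2 ((h.ann_right r).1 hs)

theorem mem_range_embedding (h : IsExactZerodivisorPair x y) {r : R} :
    r ∈ LinearMap.range h.embedding ↔ r * x = 0 := by
  rw [h.ann_left, Ideal.mem_span_singleton']
  constructor
  · rintro ⟨s, rfl⟩
    obtain ⟨t, rfl⟩ := Ideal.Quotient.mk_surjective s
    exact ⟨t, rfl⟩
  · rintro ⟨t, rfl⟩
    exact ⟨Ideal.Quotient.mk _ t, rfl⟩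

theorem exact_embedding_mkQ (h : IsExactZerodivisorPair x y) :
    Function.Exact h.symm.embedding (Ideal.span {x}).mkQ := by
  intro r
  rw [Submodule.mkQ_apply, Submodule.Quotient.mk_eq_zero, ← h.ann_right]
  exact h.symm.mem_range_embedding.symm

/-- The first syzygy of `R/(x)` is `R/(y)`, so dimension shifting swaps `x` and `y`; hence the
induction runs over all pairs at once. -/
theorem subsingleton_ext_quotient (i : ℕ) : ∀ {x y : R}, IsExactZerodivisorPair x y →
    Subsingleton (Ext (ModuleCat.of R (R ⧸ Ideal.span {x})) (ModuleCat.of R R) (1 + i)) := by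
  induction i with
  | zero =>
    intro x y h
    refine subsingleton_ext_one_of_extend h.symm.embedding_injective h.exact_embedding_mkQ
      (Submodule.mkQ_surjective _) (ExtVanishes.of_projective 1 one_pos) fun φ => ?_
    -- A map `R/(y) → R` sends 1 into `(0 : y) = (x)`, say to `d * x`, so it extends along the
    -- embedding as multiplication by `d`.
    have h1 : φ (Ideal.Quotient.mk _ 1) * y = 0 := by
      rw [mul_comm, ← smul_eq_mul, ← map_smul]
      have : y • (Ideal.Quotient.mk (Ideal.span {y}) 1) = 0 := by
        change Ideal.Quotient.mk (Ideal.span {y}) (y * 1) = 0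
        rw [mul_one]
        exact Ideal.Quotient.eq_zero_iff_mem.2 (Ideal.mem_span_singleton_self y)
      rw [this, map_zero]
    obtain ⟨d, hd⟩ := Ideal.mem_span_singleton'.1 ((h.ann_right _).1 h1)
    refine ⟨LinearMap.mulRight R d, ?_⟩
    ext
    simp only [LinearMap.comp_apply, LinearMap.mulRight_apply, Submodule.mkQ_apply]
    change 1 * x * d = φ (Ideal.Quotient.mk _ 1)
    rw [← hd]; ring
  | succ i ih =>
    intro x y h
    refine subsingleton_ext_right h.symm.embedding_injective h.exact_embedding_mkQ
      (Submodule.mkQ_surjective _) ?_ (ExtVanishes.of_projective _ (by omega))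
    rw [add_comm i 1]
    exact ih h.symm

theorem extVanishes_quotient (h : IsExactZerodivisorPair x y) :
    ExtVanishes R (R ⧸ Ideal.span {x}) := by
  intro i hi
  obtain ⟨j, rfl⟩ := Nat.exists_eq_add_of_lt hi
  rw [zero_add, add_comm]
  exact subsingleton_ext_quotient j h

section ChangeOfRings

variable (N : Type u) [AddCommGroup N] [Module R N] [Module (R ⧸ Ideal.span {x}) N]
  [IsScalarTower R (R ⧸ Ideal.span {x}) N]

/-- For an `R/(x)`-module `N`, composition with `R/(x) ≅ (0 : x) ⊆ R` identifies the `R/(x)`-dual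
of `N` with its `R`-dual. -/
noncomputable def dualEquiv (h : IsExactZerodivisorPair x y) :
    Module.Dual (R ⧸ Ideal.span {x}) N ≃ₗ[R] Module.Dual R N :=
  LinearEquiv.ofBijective
    { toFun := fun g => h.embedding ∘ₗ g.restrictScalars R
      map_add' := fun g g' => by ext; simp
      map_smul' := fun r g => by ext; simp } <| by
    constructor
    · intro g g' hg
      ext n
      exact h.embedding_injective (LinearMap.congr_fun hg n)
    · intro f
      have hf : ∀ n, f n ∈ LinearMap.range h.embedding := fun n => by
        rw [h.mem_range_embedding, mul_comm, ← smul_eq_mul, ← map_smul,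
          ← algebraMap_smul (R ⧸ Ideal.span {x}) x n]
        have : algebraMap R (R ⧸ Ideal.span {x}) x = 0 :=
          Ideal.Quotient.eq_zero_iff_mem.2 (Ideal.mem_span_singleton_self x)
        rw [this, zero_smul, map_zero]
      let e := LinearEquiv.ofInjective h.embedding h.embedding_injective
      refine ⟨LinearMap.extendScalarsOfSurjective Ideal.Quotient.mk_surjective
        (e.symm.toLinearMap ∘ₗ f.codRestrict _ hf), ?_⟩
      ext n
      exact congrArg Subtype.val (e.apply_symm_apply ⟨f n, hf n⟩)

@[simp]
theorem dualEquiv_apply (h : IsExactZerodivisorPair x y)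
    (g : Module.Dual (R ⧸ Ideal.span {x}) N) (n : N) :
    h.dualEquiv N g n = h.embedding (g n) := rfl

end ChangeOfRings

theorem isTotallyReflexive_quotient (h : IsExactZerodivisorPair x y) :
    IsTotallyReflexive R (R ⧸ Ideal.span {x}) := by
  have e : Module.Dual R (R ⧸ Ideal.span {x}) ≃ₗ[R] R ⧸ Ideal.span {x} :=
    (h.dualEquiv _).symm.trans
      ((LinearMap.ringLmapEquivSelf (R ⧸ Ideal.span {x}) (R ⧸ Ideal.span {x})
        (R ⧸ Ideal.span {x})).restrictScalars R)
  refine ⟨inferInstance, ⟨?_, ?_⟩, h.extVanishes_quotient, h.extVanishes_quotient.equiv e⟩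
  · intro s t hst
    exact h.embedding_injective (LinearMap.congr_fun hst h.embedding)
  · intro Θ
    -- The dual of `R/(x)` is generated by the embedding, so `Θ` is determined by one value, which
    -- lies in `(0 : x)`, the image of the embedding.
    have h1 : Θ h.embedding * x = 0 := by
      rw [mul_comm, ← smul_eq_mul, ← map_smul]
      have : x • h.embedding = 0 := by
        ext
        change x * (1 * y) = 0
        rw [one_mul, h.mul_eq_zero]
      rw [this, map_zero]
    obtain ⟨s, hs⟩ := h.mem_range_embedding.2 h1
    refine ⟨s, ?_⟩
    ext f
    obtain ⟨g, rfl⟩ := (h.dualEquiv _).surjective f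
    obtain ⟨r, hr⟩ := Ideal.Quotient.mk_surjective (g 1)
    have hg : h.dualEquiv _ g = r • h.embedding := by
      ext
      simp only [LinearMap.comp_apply]
      change h.embedding (g 1) = r * h.embedding 1
      rw [← hr, embedding_mk, ← map_one (Ideal.Quotient.mk (Ideal.span {x})), embedding_mk, one_mul]
    rw [hg, map_smul, map_smul, ← hs]
    rfl

theorem isTotallyReflexive_of_extension (h : IsExactZerodivisorPair x y) {r : ℕ}
    {M : ModuleCat.{u} R} (hM : IsExtensionModule x y r M) : IsTotallyReflexive R M := by
  obtain ⟨f, g, hf, hfg, hg⟩ := hM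
  exact .of_shortExact hf hfg hg (h.isTotallyReflexive_quotient.pi r)
    h.symm.isTotallyReflexive_quotient

/-- `R/(x)`-linear maps into `R/(x)` are the same as `R`-linear maps into `R`, so for `Ext¹` the
extension problem can be solved over `R`. Higher degrees follow by passing to a syzygy over `R/(x)`,
whose `R`-Ext still vanishes because `(R/(x))^n` is totally reflexive over `R`. -/
theorem subsingleton_ext_of_extVanishes [IsNoetherianRing R] (h : IsExactZerodivisorPair x y)
    (i : ℕ) : ∀ (N : Type u) [AddCommGroup N] [Module R N] [Module (R ⧸ Ideal.span {x}) N]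
      [IsScalarTower R (R ⧸ Ideal.span {x}) N] [Module.Finite (R ⧸ Ideal.span {x}) N],
      ExtVanishes R N → Subsingleton (Ext (ModuleCat.of (R ⧸ Ideal.span {x}) N)
        (ModuleCat.of _ (R ⧸ Ideal.span {x})) (1 + i)) := by
  induction i with
  | zero =>
    intro N _ _ _ _ _ hN
    obtain ⟨n, g, hg⟩ := Module.Finite.exists_fin' (R ⧸ Ideal.span {x}) N
    refine subsingleton_ext_one_of_extend (LinearMap.ker g).injective_subtype
      (LinearMap.exact_subtype_ker_map g) hg (ExtVanishes.of_projective 1 one_pos) fun φ => ?_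
    obtain ⟨ψ, hψ⟩ := exists_extend_of_subsingleton_ext
      (f := (LinearMap.ker g).subtype.restrictScalars R) (g := g.restrictScalars R)
      (LinearMap.ker g).injective_subtype (LinearMap.exact_subtype_ker_map g) hg (hN 1 one_pos)
      (h.dualEquiv _ φ)
    obtain ⟨χ, rfl⟩ := (h.dualEquiv _).surjective ψ
    refine ⟨χ, ?_⟩
    ext l
    exact h.embedding_injective (LinearMap.congr_fun hψ l)
  | succ i ih =>
    intro N _ _ _ _ _ hN
    obtain ⟨n, g, hg⟩ := Module.Finite.exists_fin' (R ⧸ Ideal.span {x}) N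
    refine subsingleton_ext_right (LinearMap.ker g).injective_subtype
      (LinearMap.exact_subtype_ker_map g) hg ?_ (ExtVanishes.of_projective _ (by omega))
    rw [add_comm i 1]
    refine ih (LinearMap.ker g) ?_
    exact ExtVanishes.left
      (f := (LinearMap.ker g).subtype.restrictScalars R) (g := g.restrictScalars R)
      (LinearMap.ker g).injective_subtype (LinearMap.exact_subtype_ker_map g) hg
      (h.isTotallyReflexive_quotient.pi n).ext_eq_zero hN

theorem isTotallyReflexive_changeOfRings [IsNoetherianRing R] (h : IsExactZerodivisorPair x y)
    {N : Type u} [AddCommGroup N] [Module R N] [Module (R ⧸ Ideal.span {x}) N]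
    [IsScalarTower R (R ⧸ Ideal.span {x}) N] (hN : IsTotallyReflexive R N) :
    IsTotallyReflexive (R ⧸ Ideal.span {x}) N := by
  have := hN.finite
  have : Module.Finite (R ⧸ Ideal.span {x}) N := Module.Finite.of_restrictScalars_finite R _ _
  have key : ∀ (K : Type u) [AddCommGroup K] [Module R K] [Module (R ⧸ Ideal.span {x}) K]
      [IsScalarTower R (R ⧸ Ideal.span {x}) K] [Module.Finite (R ⧸ Ideal.span {x}) K],
      ExtVanishes R K → ExtVanishes (R ⧸ Ideal.span {x}) K := by
    intro K _ _ _ _ _ hK i hi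
    obtain ⟨j, rfl⟩ := Nat.exists_eq_add_of_lt hi
    rw [zero_add, add_comm]
    exact h.subsingleton_ext_of_extVanishes j K hK
  refine ⟨this, ⟨?_, ?_⟩, key N hN.ext_eq_zero, ?_⟩
  · intro m n hmn
    refine hN.reflexive.1 ?_
    ext f
    obtain ⟨g, rfl⟩ := (h.dualEquiv _).surjective f
    exact congrArg h.embedding (LinearMap.congr_fun hmn g)
  · intro θ
    obtain ⟨n, hn⟩ := hN.reflexive.2
      (h.embedding ∘ₗ θ.restrictScalars R ∘ₗ (h.dualEquiv N).symm.toLinearMap)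
    refine ⟨n, ?_⟩
    ext g
    have := LinearMap.congr_fun hn (h.dualEquiv N g)
    simp at this
    exact h.embedding_injective this
  · have : Module.Finite (R ⧸ Ideal.span {x}) (Module.Dual (R ⧸ Ideal.span {x}) N) :=
      inferInstance
    exact key _ (ExtVanishes.equiv hN.ext_dual_eq_zero (h.dualEquiv N))

end IsExactZerodivisorPair

/-! ### A criterion for indecomposability of extensions -/

section Indecomposable

variable {R : Type u} [CommRing R] [IsLocalRing R] {x y : R}

theorem IsExactZerodivisorPair.nontrivial_quotient_right (h : IsExactZerodivisorPair x y) :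
    Nontrivial (R ⧸ Ideal.span {y}) := by
  rw [Ideal.Quotient.nontrivial_iff, Ne, Ideal.span_singleton_eq_top]
  exact (IsLocalRing.mem_maximalIdeal y).1 h.right_mem

/-- Here `Z` is an image of `(R/(x))^r`, hence an `R/(x)`-module, and free by G-regularity; a
coordinate of a nonzero `Z` would contradict `H`. -/
theorem subsingleton_snd_of_isUnit [IsNoetherianRing R] (h : IsExactZerodivisorPair x y)
    (hG : IsGRegular (R ⧸ Ideal.span {x})) {M Y Z : Type u} [AddCommGroup M] [Module R M]
    [AddCommGroup Y] [Module R Y] [AddCommGroup Z] [Module R Z] {r : ℕ}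
    {f : (Fin r → R ⧸ Ideal.span {x}) →ₗ[R] M} {g : M →ₗ[R] R ⧸ Ideal.span {y}}
    (hfg : Function.Exact f g) (hM : IsTotallyReflexive R M)
    (H : ∀ (ρ : M →ₗ[R] R ⧸ Ideal.span {x}) v, ρ (f v) ≠ 1)
    (e : M ≃ₗ[R] Y × Z) {a : Y} (ha : IsUnit (g (e.symm (a, 0)))) : Subsingleton Z := by
  have hsurj : ∀ z : Z, ∃ v, (e (f v)).2 = z := by
    intro z
    obtain ⟨u, hu⟩ := ha
    -- The multiple `t • a` cancels the image of `z` under `g`, so `(t • a, z)` comes from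
    -- `(R/(x))^r`.
    obtain ⟨t, ht⟩ := Ideal.Quotient.mk_surjective (-(g (e.symm (0, z))) * (↑u⁻¹ : R ⧸ Ideal.span {y}))
    have h0 : g (e.symm (t • a, z)) = 0 := by
      have h1 : ((t • a, z) : Y × Z) = t • (a, 0) + (0, z) := by simp
      have h2 : t • g (e.symm (a, 0)) = Ideal.Quotient.mk _ t * g (e.symm (a, 0)) := by
        rw [Algebra.smul_def]; rfl
      rw [h1, map_add, map_smul, map_add, map_smul, h2, ht, ← hu, mul_assoc, Units.inv_mul]
      ring
    obtain ⟨v, hv⟩ := (hfg _).1 h0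
    exact ⟨v, by rw [hv, LinearEquiv.apply_symm_apply]⟩
  have hx : ∀ s : R ⧸ Ideal.span {x}, x • s = 0 := by
    intro s
    have : Ideal.Quotient.mk (Ideal.span {x}) x = 0 :=
      Ideal.Quotient.eq_zero_iff_mem.2 (Ideal.mem_span_singleton_self x)
    rw [Algebra.smul_def]
    exact (congrArg (· * s) this).trans (zero_mul s)
  have htors : Module.IsTorsionBy R Z x := by
    intro z
    obtain ⟨v, rfl⟩ := hsurj z
    have hv : x • v = 0 := funext fun i => hx (v i)
    rw [← Prod.smul_snd, ← map_smul, ← map_smul, hv]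
    simp
  let _ : Module (R ⧸ Ideal.span {x}) Z := htors.module
  have : IsScalarTower R (R ⧸ Ideal.span {x}) Z :=
    Module.IsTorsionBySet.isScalarTower ((Module.isTorsionBySet_span_singleton_iff x).2 htors)
  have hZ : IsTotallyReflexive R Z := hM.retract
    (e.symm.toLinearMap ∘ₗ LinearMap.inr R Y Z) (LinearMap.snd R Y Z ∘ₗ e.toLinearMap)
    (by ext; simp)
  have hfree := hG Z (h.isTotallyReflexive_changeOfRings hZ)
  by_contra hns
  have := not_subsingleton_iff_nontrivial.1 hns
  let B := Module.Free.chooseBasis (R ⧸ Ideal.span {x}) Z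
  obtain ⟨j⟩ := B.index_nonempty
  obtain ⟨v, hv⟩ := hsurj (B j)
  refine H ((B.coord j).restrictScalars R ∘ₗ LinearMap.snd R Y Z ∘ₗ e.toLinearMap) v ?_
  simp [hv]

open CategoryTheory in
theorem indecomposable_of_extension [IsNoetherianRing R] (h : IsExactZerodivisorPair x y)
    (hG : IsGRegular (R ⧸ Ideal.span {x})) {M : ModuleCat.{u} R} {r : ℕ}
    {f : (Fin r → R ⧸ Ideal.span {x}) →ₗ[R] M} {g : M →ₗ[R] R ⧸ Ideal.span {y}}
    (hfg : Function.Exact f g) (hg : Function.Surjective g) (hM : IsTotallyReflexive R M)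
    (H : ∀ (ρ : M →ₗ[R] R ⧸ Ideal.span {x}) v, ρ (f v) ≠ 1) : Indecomposable M := by
  have := h.nontrivial_quotient_right
  have : IsLocalRing (R ⧸ Ideal.span {y}) :=
    .of_surjective' (Ideal.Quotient.mk _) Ideal.Quotient.mk_surjective
  refine ⟨fun hz => ?_, fun Y Z i => ?_⟩
  · have := ModuleCat.subsingleton_of_isZero hz
    exact not_subsingleton _ hg.subsingleton
  · let e : M ≃ₗ[R] Y × Z := (i ≪≫ ModuleCat.biprodIsoProd Y Z).toLinearEquiv
    obtain ⟨m, hm⟩ := hg 1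
    obtain ⟨⟨a, b⟩, rfl⟩ := e.symm.surjective m
    have hab : ((a, b) : Y × Z) = (a, 0) + (0, b) := by simp
    rw [hab, map_add, map_add] at hm
    rcases IsLocalRing.isUnit_or_isUnit_of_isUnit_add (hm ▸ isUnit_one) with hu | hu
    · right
      have := subsingleton_snd_of_isUnit h hG hfg hM H e hu
      exact ModuleCat.isZero_of_subsingleton Z
    · left
      have := subsingleton_snd_of_isUnit h hG hfg hM H
        (e.trans (LinearEquiv.prodComm R Y Z)) (a := b) hu
      exact ModuleCat.isZero_of_subsingleton Y

end Indecomposable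

/-! ### The explicit extensions `M_b` -/

section ExtensionModule

variable {R : Type u} [CommRing R] (x y : R) {r : ℕ}

/-- The extension of `R/(y)` by `(R/(x))^r` whose class in `Ext¹ = (R/(x,y))^r` is that of `b`. -/
abbrev ExtensionModule (b : Fin r → R) : Type u :=
  ((Fin r → R ⧸ Ideal.span {x}) × R) ⧸
    Submodule.span R {((fun i => Ideal.Quotient.mk (Ideal.span {x}) (b i), y) :
      (Fin r → R ⧸ Ideal.span {x}) × R)}

variable (b : Fin r → R)

/-- The inclusion of `(R/(x))^r` in the extension. -/
def ExtensionModule.inclusion : (Fin r → R ⧸ Ideal.span {x}) →ₗ[R] ExtensionModule x y b :=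
  Submodule.mkQ _ ∘ₗ LinearMap.inl R _ _

/-- The projection of the extension onto `R/(y)`. -/
def ExtensionModule.projection : ExtensionModule x y b →ₗ[R] R ⧸ Ideal.span {y} :=
  Submodule.liftQ _ ((Ideal.span {y}).mkQ ∘ₗ LinearMap.snd R _ _) (by
    rw [Submodule.span_singleton_le_iff_mem, LinearMap.mem_ker]
    exact (Submodule.Quotient.mk_eq_zero _).2 (Ideal.mem_span_singleton_self y))

theorem ExtensionModule.projection_surjective :
    Function.Surjective (ExtensionModule.projection x y b) := by
  intro t
  obtain ⟨s, rfl⟩ := Ideal.Quotient.mk_surjective t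
  exact ⟨Submodule.Quotient.mk (0, s), rfl⟩

theorem ExtensionModule.exact :
    Function.Exact (ExtensionModule.inclusion x y b) (ExtensionModule.projection x y b) := by
  intro m
  constructor
  · obtain ⟨⟨v, t⟩, rfl⟩ := Submodule.Quotient.mk_surjective _ m
    intro ht
    have ht : t ∈ Ideal.span {y} := (Submodule.Quotient.mk_eq_zero _).1 ht
    obtain ⟨c, rfl⟩ := Ideal.mem_span_singleton'.1 ht
    refine ⟨v - c • fun i => Ideal.Quotient.mk (Ideal.span {x}) (b i), ?_⟩
    refine ((Submodule.Quotient.eq _).2 ?_)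
    rw [Submodule.mem_span_singleton]
    exact ⟨-c, by ext <;> simp⟩
  · rintro ⟨v, rfl⟩
    change (Submodule.Quotient.mk 0 : R ⧸ Ideal.span {y}) = 0
    simp

theorem ExtensionModule.relation :
    (ExtensionModule.inclusion x y b fun i => Ideal.Quotient.mk (Ideal.span {x}) (b i)) +
      y • (Submodule.Quotient.mk (0, 1) : ExtensionModule x y b) = 0 := by
  rw [← Submodule.Quotient.mk_smul]
  change Submodule.Quotient.mk (_ + _) = _
  rw [Submodule.Quotient.mk_eq_zero, Submodule.mem_span_singleton]
  exact ⟨1, by ext <;> simp⟩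

variable {x y}

/-- If `(v, 0) = c (b, y)` then `c y = 0`, so `c` lies in `(x)` and kills `(R/(x))^r`, giving `v =
0`. -/
theorem ExtensionModule.inclusion_injective [IsLocalRing R] (h : IsExactZerodivisorPair x y) :
    Function.Injective (ExtensionModule.inclusion x y b) := by
  rw [injective_iff_map_eq_zero]
  intro v hv
  have hv : (v, (0 : R)) ∈ Submodule.span R _ := (Submodule.Quotient.mk_eq_zero _).1 hv
  obtain ⟨c, hc⟩ := Submodule.mem_span_singleton.1 hv
  rw [Prod.smul_mk, Prod.mk.injEq] at hc
  obtain ⟨rfl, hy⟩ := hc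
  have hc : Ideal.Quotient.mk (Ideal.span {x}) c = 0 :=
    Ideal.Quotient.eq_zero_iff_mem.2 ((h.ann_right c).1 hy)
  ext i
  simp only [Pi.smul_apply, Algebra.smul_def]
  exact (congrArg (· * _) hc).trans (zero_mul _)

theorem ExtensionModule.isExtensionModule [IsLocalRing R] (h : IsExactZerodivisorPair x y) :
    IsExtensionModule x y r (ModuleCat.of R (ExtensionModule x y b)) :=
  ⟨inclusion x y b, projection x y b, inclusion_injective b h, ExtensionModule.exact x y b,
    projection_surjective x y b⟩

theorem ExtensionModule.indecomposable [IsLocalRing R] [IsNoetherianRing R]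
    (h : IsExactZerodivisorPair x y) (hG : IsGRegular (R ⧸ Ideal.span {x}))
    (hb : ∀ c : Fin r → R, ∑ i, c i * b i ∈ Ideal.span {x, y} →
      ∀ i, c i ∈ IsLocalRing.maximalIdeal R) :
    CategoryTheory.Indecomposable (ModuleCat.of R (ExtensionModule x y b)) := by
  refine indecomposable_of_extension h hG (f := inclusion x y b) (ExtensionModule.exact x y b)
    (projection_surjective x y b) (h.isTotallyReflexive_of_extension (isExtensionModule b h)) ?_
  intro ρ v hv
  have lin : ∀ w : Fin r → R, ρ (inclusion x y b fun i => Ideal.Quotient.mk _ (w i)) =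
      ∑ i, w i • ρ (inclusion x y b (Pi.single i 1)) := by
    intro w
    rw [← Finset.sum_congr rfl fun i _ => map_smul ρ (w i) _, ← map_sum,
      ← Finset.sum_congr rfl fun i _ => map_smul (inclusion x y b) (w i) _, ← map_sum]
    congr 2
    ext i
    simp [Finset.sum_apply, Pi.single_apply, Algebra.smul_def]
  choose c hc using fun i => Ideal.Quotient.mk_surjective (ρ (inclusion x y b (Pi.single i 1)))
  choose w hw using fun i => Ideal.Quotient.mk_surjective (v i)
  obtain ⟨d, hd⟩ := Ideal.Quotient.mk_surjective (ρ (Submodule.Quotient.mk (0, 1)))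
  have lin' : ∀ w : Fin r → R, ρ (inclusion x y b fun i => Ideal.Quotient.mk _ (w i)) =
      Ideal.Quotient.mk _ (∑ i, w i * c i) := by
    intro w
    rw [lin, map_sum]
    refine Finset.sum_congr rfl fun i _ => ?_
    rw [← hc, Algebra.smul_def, map_mul]; rfl
  -- Applying `ρ` to the defining relation gives `∑ b i * c i + y * d ∈ (x)`, so `hb` puts all `c i`
  -- in the maximal ideal and `ρ` cannot take the value 1 on the submodule.
  have hrel := congrArg ρ (relation x y b)
  rw [map_add, map_smul, lin', ← hd, map_zero, Algebra.smul_def] at hrel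
  have hrel : Ideal.Quotient.mk (Ideal.span {x}) (∑ i, b i * c i + y * d) = 0 := by
    rw [map_add, map_mul]; exact hrel
  have hmem := Ideal.Quotient.eq_zero_iff_mem.1 hrel
  have hcm := hb c (by
    have h1 : ∑ i, c i * b i = (∑ i, b i * c i + y * d) - d * y := by
      simp only [mul_comm]; ring
    rw [h1]
    refine sub_mem (Ideal.span_mono (by simp) hmem) (Ideal.mul_mem_left _ _ ?_)
    exact Ideal.subset_span (by simp))
  have hv' : v = fun i => Ideal.Quotient.mk _ (w i) := funext fun i => (hw i).symm
  rw [hv', lin', ← map_one (Ideal.Quotient.mk _), Ideal.Quotient.eq] at hv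
  have h1 : ∑ i, w i * c i ∈ IsLocalRing.maximalIdeal R :=
    sum_mem fun i _ => Ideal.mul_mem_left _ _ (hcm i)
  have h2 := Ideal.span_le.2 (Set.singleton_subset_iff.2 h.left_mem) hv
  have h3 := sub_mem h1 h2
  rw [sub_sub_cancel] at h3
  exact (Ideal.ne_top_iff_one _).1 (IsLocalRing.maximalIdeal.isMaximal R).ne_top h3

/-- The ideal `(x, y, b)` is determined by the isomorphism class of the extension. -/
theorem ExtensionModule.mem_of_linearEquiv [IsNoetherianRing R] {b b' : Fin r → R}
    (e : ExtensionModule x y b' ≃ₗ[R] ExtensionModule x y b) (i : Fin r) :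
    b' i ∈ Ideal.span ({x, y} ∪ Set.range b) := by
  set 𝔞 := Ideal.span ({x, y} ∪ Set.range b) with h𝔞
  have hx : x ∈ 𝔞 := Ideal.subset_span (by simp)
  have hy : y ∈ 𝔞 := Ideal.subset_span (by simp)
  have hb : ∀ i, b i ∈ 𝔞 := fun i => Ideal.subset_span (by simp)
  let q : (R ⧸ Ideal.span {x}) →ₗ[R] R ⧸ 𝔞 :=
    Submodule.mapQ _ _ LinearMap.id (Ideal.span_le.2 (Set.singleton_subset_iff.2 hx))
  let π₀ : ((Fin r → R ⧸ Ideal.span {x}) × R) →ₗ[R] (Fin r → R ⧸ 𝔞) × (R ⧸ 𝔞) :=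
    (q.compLeft (Fin r)).prodMap 𝔞.mkQ
  have hq : ∀ t : R, q (Ideal.Quotient.mk _ t) = Ideal.Quotient.mk _ t := fun _ => rfl
  let π : ExtensionModule x y b →ₗ[R] (Fin r → R ⧸ 𝔞) × (R ⧸ 𝔞) :=
    Submodule.liftQ _ π₀ (by
      rw [Submodule.span_singleton_le_iff_mem, LinearMap.mem_ker]
      refine Prod.ext (funext fun i => ?_) ?_
      · exact Ideal.Quotient.eq_zero_iff_mem.2 (hb i)
      · exact Ideal.Quotient.eq_zero_iff_mem.2 hy)
  have hπ₀ : Function.Surjective π₀ := by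
    rintro ⟨v, t⟩
    obtain ⟨t, rfl⟩ := Ideal.Quotient.mk_surjective t
    choose w hw using fun i => Ideal.Quotient.mk_surjective (v i)
    exact ⟨(fun i => Ideal.Quotient.mk _ (w i), t), Prod.ext (funext fun i => hw i) rfl⟩
  have hπ : Function.Surjective π := fun v => by
    obtain ⟨w, rfl⟩ := hπ₀ v
    exact ⟨Submodule.Quotient.mk w, rfl⟩
  -- Modulo `𝔞` the module `M_b` becomes free of rank `r + 1`. Presenting it through `M_{b'}`
  -- instead induces a surjective endomorphism `Φ` of this Noetherian module, which is therefore
  -- injective; so the relation `(b', y)` already vanishes modulo `𝔞`.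
  let Θ : ((Fin r → R ⧸ Ideal.span {x}) × R) →ₗ[R] (Fin r → R ⧸ 𝔞) × (R ⧸ 𝔞) :=
    π ∘ₗ e.toLinearMap ∘ₗ Submodule.mkQ _
  have hΘ : Function.Surjective Θ :=
    hπ.comp (e.surjective.comp (Submodule.mkQ_surjective _))
  have hkill : ∀ t ∈ 𝔞, ∀ w : (Fin r → R ⧸ 𝔞) × (R ⧸ 𝔞), t • w = 0 := by
    intro t ht w
    have : ∀ s : R ⧸ 𝔞, t • s = 0 := fun s => by
      rw [Algebra.smul_def]
      exact (congrArg (· * s) (Ideal.Quotient.eq_zero_iff_mem.2 ht)).trans (zero_mul s)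
    exact Prod.ext (funext fun i => this _) (this _)
  have hker : LinearMap.ker π₀ ≤ LinearMap.ker Θ := by
    rintro ⟨v, t⟩ hvt
    choose w hw using fun i => Ideal.Quotient.mk_surjective (v i)
    have h1 : ∀ i, w i ∈ 𝔞 := fun i => by
      have : q (v i) = 0 := congrFun (congrArg Prod.fst hvt) i
      rw [← hw i, hq] at this
      exact Ideal.Quotient.eq_zero_iff_mem.1 this
    have h2 : t ∈ 𝔞 := Ideal.Quotient.eq_zero_iff_mem.1 (congrArg Prod.snd hvt)
    have h3 : ((v, t) : (Fin r → R ⧸ Ideal.span {x}) × R) =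
        ∑ i, w i • (Pi.single i 1, 0) + t • (0, 1) := by
      refine Prod.ext (funext fun i => ?_) ?_
      · simp [Prod.fst_sum, Finset.sum_apply, Pi.single_apply, Algebra.smul_def, ← hw]
      · simp [Prod.snd_sum]
    rw [LinearMap.mem_ker, h3, map_add, map_sum, map_smul, hkill t h2, add_zero]
    exact Finset.sum_eq_zero fun i _ => by rw [map_smul, hkill _ (h1 i)]
  let Φ : Module.End R ((Fin r → R ⧸ 𝔞) × (R ⧸ 𝔞)) :=
    (LinearMap.ker π₀).liftQ Θ hker ∘ₗ (π₀.quotKerEquivOfSurjective hπ₀).symm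
  have hΦ : ∀ w, Φ (π₀ w) = Θ w := by
    intro w
    have : (π₀.quotKerEquivOfSurjective hπ₀).symm (π₀ w) = Submodule.Quotient.mk w := by
      rw [LinearEquiv.symm_apply_eq]; rfl
    change (LinearMap.ker π₀).liftQ Θ hker ((π₀.quotKerEquivOfSurjective hπ₀).symm (π₀ w)) = _
    rw [this]; rfl
  have hinj : Function.Injective Φ := IsNoetherian.injective_of_surjective_endomorphism Φ
    fun v => by
      obtain ⟨w, rfl⟩ := hΘ v
      exact ⟨π₀ w, hΦ w⟩
  have hzero : π₀ (fun i => Ideal.Quotient.mk _ (b' i), y) = 0 := by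
    refine hinj ?_
    rw [hΦ, map_zero]
    change π (e (Submodule.Quotient.mk _)) = 0
    rw [(Submodule.Quotient.mk_eq_zero _).2 (Submodule.mem_span_singleton_self _)]
    simp
  exact Ideal.Quotient.eq_zero_iff_mem.1 (congrFun (congrArg Prod.fst hzero) i)

end ExtensionModule

/-! ### Growth of the number of generators of powers of the maximal ideal -/

section HilbertFunction

open IsLocalRing Module

variable {B : Type u} [CommRing B]

theorem length_quotient_eq_add_ker {K K' : Ideal B} (h : K' ≤ K) :
    length B (B ⧸ K') = length B (LinearMap.ker (Submodule.factor h)) + length B (B ⧸ K) :=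
  length_eq_add_of_exact (LinearMap.ker (Submodule.factor h)).subtype _
    (Submodule.subtype_injective _) (Submodule.factor_surjective h)
    (LinearMap.exact_subtype_ker_map _)

theorem length_quotient_add_one_le {K K' : Ideal B} (h : K' < K) :
    length B (B ⧸ K) + 1 ≤ length B (B ⧸ K') := by
  rw [length_quotient_eq_add_ker h.le, add_comm]
  gcongr
  rw [Order.one_le_iff_pos, length_pos_iff]
  obtain ⟨b, hb, hb'⟩ := SetLike.exists_of_lt h
  refine ⟨⟨Submodule.Quotient.mk b, (Submodule.Quotient.mk_eq_zero _).2 hb⟩, 0, fun h0 => hb' ?_⟩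
  exact (Submodule.Quotient.mk_eq_zero _).1 (congrArg Subtype.val h0)

variable [IsLocalRing B] [IsNoetherianRing B]

theorem length_quotient_smul_eq_spanFinrank (J : Ideal B) :
    length B (J ⧸ maximalIdeal B • (⊤ : Submodule B J)) = J.spanFinrank := by
  rw [spanFinrank_eq_finrank_quotient J (IsNoetherian.noetherian J)]
  let _ : Field (B ⧸ maximalIdeal B) := Ideal.Quotient.field _
  have : Module.Finite (B ⧸ maximalIdeal B) (J ⧸ maximalIdeal B • (⊤ : Submodule B J)) :=
    .of_restrictScalars_finite B _ _
  rw [length_eq_of_surjective (R := B ⧸ maximalIdeal B) Ideal.Quotient.mk_surjective,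
    length_eq_finrank]

theorem length_quotient_mul_le (J : Ideal B) :
    length B (B ⧸ maximalIdeal B * J) ≤ J.spanFinrank + length B (B ⧸ J) := by
  have h : maximalIdeal B * J ≤ J := Ideal.mul_le_right
  rw [length_quotient_eq_add_ker h, ← length_quotient_smul_eq_spanFinrank]
  gcongr
  let φ : (J ⧸ maximalIdeal B • (⊤ : Submodule B J)) →ₗ[B] B ⧸ maximalIdeal B * J :=
    Submodule.mapQ _ _ J.subtype (by
      rw [← Submodule.map_le_iff_le_comap, Submodule.map_smul'', Submodule.map_subtype_top]
      rfl)
  have hker : LinearMap.ker (Submodule.factor h) ≤ LinearMap.range φ := by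
    intro b hb
    obtain ⟨b, rfl⟩ := Submodule.Quotient.mk_surjective _ b
    exact ⟨Submodule.Quotient.mk ⟨b, (Submodule.Quotient.mk_eq_zero _).1 hb⟩, rfl⟩
  exact (length_le_of_injective _ (Submodule.inclusion_injective hker)).trans
    (length_le_of_surjective φ.rangeRestrict φ.surjective_rangeRestrict)

theorem length_quotient_pow_add_le {n : ℕ} (hn : ∀ j, (maximalIdeal B ^ j).spanFinrank ≤ n)
    (i c : ℕ) : length B (B ⧸ maximalIdeal B ^ (i + c)) ≤
      (n * c : ℕ) + length B (B ⧸ maximalIdeal B ^ i) := by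
  induction c with
  | zero => simp
  | succ c ih =>
    rw [← add_assoc, pow_succ']
    refine (length_quotient_mul_le _).trans ?_
    rw [mul_add_one, add_comm (n * c), Nat.cast_add, add_assoc]
    gcongr
    exact hn _

/-- The chain `(z) + 𝔪^j` is strictly decreasing: if it stalled, Nakayama would give `𝔪^j ⊆ (z) ⊆
p`, forcing `p = 𝔪`. -/
theorem le_length_quotient_sup_pow {p : Ideal B} [p.IsPrime] (hp : p ≠ maximalIdeal B) {z : B}
    (hz : z ∈ p) (j : ℕ) : (j : ℕ∞) ≤ length B (B ⧸ Ideal.span {z} ⊔ maximalIdeal B ^ j) := by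
  induction j with
  | zero => simp
  | succ j ih =>
    rw [Nat.cast_add, Nat.cast_one]
    refine (add_le_add_left ih 1).trans (length_quotient_add_one_le ?_)
    refine lt_of_le_of_ne (sup_le_sup_left (Ideal.pow_le_pow_right (Nat.le_succ j)) _) fun heq => ?_
    have h1 : maximalIdeal B ^ j ≤ Ideal.span {z} := by
      refine Submodule.le_of_le_smul_of_le_jacobson_bot (I := maximalIdeal B)
        (IsNoetherian.noetherian _) (jacobson_eq_maximalIdeal ⊥ bot_ne_top).ge ?_
      rw [smul_eq_mul, ← pow_succ', heq]
      exact le_sup_right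
    have h2 : maximalIdeal B ≤ p :=
      Ideal.IsPrime.le_of_pow_le
        (h1.trans (Ideal.span_le.2 (Set.singleton_subset_iff.2 hz)))
    exact hp (le_antisymm (le_maximalIdeal ‹p.IsPrime›.ne_top) h2)

/-- Artin–Rees gives `(𝔪^(i+c) : z) ⊆ 𝔪^i`. Thus multiplication by `z` shows that the kernel of
`B/𝔪^(i+c) → B/((z) + 𝔪^(i+c))` is at least as long as `B/𝔪^i`. -/
theorem length_quotient_pow_add_length_le [IsDomain B] {z : B} (hz : z ≠ 0) :
    ∃ c, ∀ i, length B (B ⧸ maximalIdeal B ^ i) +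
      length B (B ⧸ Ideal.span {z} ⊔ maximalIdeal B ^ (i + c)) ≤
        length B (B ⧸ maximalIdeal B ^ (i + c)) := by
  obtain ⟨c, hc⟩ := (maximalIdeal B).exists_pow_inf_eq_pow_smul (Ideal.span {z})
  refine ⟨c, fun i => ?_⟩
  rw [length_quotient_eq_add_ker (le_sup_right :
    maximalIdeal B ^ (i + c) ≤ Ideal.span {z} ⊔ maximalIdeal B ^ (i + c))]
  gcongr
  let F : B →ₗ[B] B ⧸ maximalIdeal B ^ (i + c) := Submodule.mkQ _ ∘ₗ LinearMap.mulRight B z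
  have hF : LinearMap.ker F ≤ maximalIdeal B ^ i := by
    intro b hb
    have hb : b * z ∈ maximalIdeal B ^ (i + c) := (Submodule.Quotient.mk_eq_zero _).1 hb
    have h1 : b * z ∈ maximalIdeal B ^ (i + c) • (⊤ : Ideal B) ⊓ Ideal.span {z} :=
      ⟨by simpa using hb, Ideal.mem_span_singleton'.2 ⟨b, rfl⟩⟩
    rw [hc _ (Nat.le_add_left c i), Nat.add_sub_cancel] at h1
    have h2 : b * z ∈ maximalIdeal B ^ i * Ideal.span {z} :=
      Submodule.smul_mono le_rfl inf_le_right h1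
    obtain ⟨t, ht, htz⟩ := Ideal.mem_mul_span_singleton.1 h2
    rwa [← mul_right_cancel₀ hz htz]
  have hr : LinearMap.range F ≤ LinearMap.ker (Submodule.factor (le_sup_right :
      maximalIdeal B ^ (i + c) ≤ Ideal.span {z} ⊔ maximalIdeal B ^ (i + c))) := by
    rintro _ ⟨b, rfl⟩
    exact (Submodule.Quotient.mk_eq_zero _).2
      (Ideal.mem_sup_left (Ideal.mem_span_singleton'.2 ⟨b, rfl⟩))
  calc length B (B ⧸ maximalIdeal B ^ i) ≤ length B (B ⧸ LinearMap.ker F) :=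
        length_le_of_surjective (Submodule.factor hF) (Submodule.factor_surjective hF)
    _ = length B (LinearMap.range F) := F.quotKerEquivRange.length_eq
    _ ≤ _ := length_le_of_injective _ (Submodule.inclusion_injective hr)

/-- In a Noetherian local domain of dimension at least two, the numbers of generators of the powers
of the maximal ideal are unbounded. -/
theorem exists_lt_spanFinrank_pow_maximalIdeal [IsDomain B] {p : Ideal B} [p.IsPrime]
    (hp0 : p ≠ ⊥) (hp : p ≠ maximalIdeal B) (n : ℕ) :
    ∃ j, n < (maximalIdeal B ^ j).spanFinrank := by
  by_contra! hn
  obtain ⟨z, hz, hz0⟩ := Submodule.exists_mem_ne_zero_of_ne_bot hp0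
  obtain ⟨c, hc⟩ := length_quotient_pow_add_length_le hz0
  -- If all powers had at most `n` generators, then `B/𝔪^(i+c)` would exceed `B/𝔪^i` in length by at
  -- most `n * c`, yet by at least `i + c`; this `i` makes that absurd.
  set i := n * c + 1
  have hfin : length B (B ⧸ maximalIdeal B ^ i) ≠ ⊤ := by
    have := length_quotient_pow_add_le hn 0 i
    have h0 : Subsingleton (B ⧸ maximalIdeal B ^ 0) :=
      Ideal.Quotient.subsingleton_iff.2 (by rw [pow_zero, Ideal.one_eq_top])
    rw [zero_add, length_eq_zero (M := B ⧸ maximalIdeal B ^ 0), add_zero] at this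
    exact ne_top_of_le_ne_top (ENat.natCast_ne_top _) this
  have h1 := (add_le_add_right (le_length_quotient_sup_pow hp hz (i + c)) _).trans
    ((hc i).trans (length_quotient_pow_add_le hn i c))
  rw [add_comm] at h1
  have h2 := (ENat.add_le_add_iff_right hfin).1 h1
  have h3 : i + c ≤ n * c := by exact_mod_cast h2
  omega

end HilbertFunction

/-! ### Ideals with many generators, and minimal generating sets -/

section GeneratorBounds

open IsLocalRing

theorem exists_lt_spanFinrank_of_two_le_height {A : Type u} [CommRing A] [IsLocalRing A]
    [IsNoetherianRing A] {I : Ideal A} (hI : I ≠ ⊤) (h : 2 ≤ I.height) (n : ℕ) :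
    ∃ J : Ideal A, n < J.spanFinrank := by
  have hm : ¬ (maximalIdeal A).height ≤ (1 : ℕ) := fun hle => by
    have := (h.trans (Ideal.height_mono (le_maximalIdeal hI))).trans hle
    exact absurd this (by norm_num)
  rw [Ideal.height_le_iff] at hm
  push Not at hm
  obtain ⟨q, hq, hqm, hq1⟩ := hm
  have hq0 : ¬ q.height ≤ (0 : ℕ) := fun hle => absurd (hq1.trans hle) (by norm_num)
  rw [Ideal.height_le_iff] at hq0
  push Not at hq0
  -- The chain `P < q < 𝔪` makes `A/P` a domain in which the image of `q` is a nonzero nonmaximal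
  -- prime.
  obtain ⟨P, hP, hPq, -⟩ := hq0
  have : IsLocalRing (A ⧸ P) := .of_surjective' (Ideal.Quotient.mk P) Ideal.Quotient.mk_surjective
  have hker : RingHom.ker (Ideal.Quotient.mk P) ≤ q := by rw [Ideal.mk_ker]; exact hPq.le
  have hprime : (q.map (Ideal.Quotient.mk P)).IsPrime :=
    Ideal.map_isPrime_of_surjective Ideal.Quotient.mk_surjective hker
  have hcomap : (q.map (Ideal.Quotient.mk P)).comap (Ideal.Quotient.mk P) = q := by
    rw [Ideal.comap_map_of_surjective' _ Ideal.Quotient.mk_surjective, sup_eq_left]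
    exact hker
  obtain ⟨j, hj⟩ := exists_lt_spanFinrank_pow_maximalIdeal (B := A ⧸ P)
    (p := q.map (Ideal.Quotient.mk P)) (fun h0 => by
      rw [h0, ← RingHom.ker_eq_comap_bot, Ideal.mk_ker] at hcomap
      exact hPq.ne hcomap) (fun h0 => by
      rw [h0] at hcomap
      have : (maximalIdeal (A ⧸ P)).comap (Ideal.Quotient.mk P) = maximalIdeal A :=
        ((local_hom_TFAE (Ideal.Quotient.mk P)).out 0 4).1
          (IsLocalHom.of_surjective _ Ideal.Quotient.mk_surjective)
      exact hqm.ne (hcomap.symm.trans this)) n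
  refine ⟨(maximalIdeal (A ⧸ P) ^ j).comap (Ideal.Quotient.mk P), hj.trans_le ?_⟩
  conv_lhs => rw [← Ideal.map_comap_of_surjective (Ideal.Quotient.mk P)
    Ideal.Quotient.mk_surjective (maximalIdeal (A ⧸ P) ^ j)]
  exact Ideal.spanFinrank_map_le_of_fg _ (IsNoetherian.noetherian _)

/-- In a generating set of least size, a relation with a unit coefficient would make one generator
redundant. -/
theorem exists_generators_of_spanFinrank {R : Type u} [CommRing R]
    [IsNoetherianRing R] [IsLocalRing R] (J : Ideal R) :
    ∃ a : Fin J.spanFinrank → R, ∀ c : Fin J.spanFinrank → R, ∑ i, c i * a i = 0 →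
      ∀ i, c i ∈ maximalIdeal R := by
  classical
  obtain ⟨s, hs, hspan⟩ :=
    Submodule.FG.exists_span_finset_card_eq_spanFinrank (IsNoetherian.noetherian J)
  let e : Fin J.spanFinrank ≃ s := (s.equivFinOfCardEq hs).symm
  refine ⟨fun i => (e i : R), fun c hc i => ?_⟩
  by_contra hi
  rw [mem_maximalIdeal, mem_nonunits_iff, not_not] at hi
  have hmem : ((e i : s) : R) ∈ Ideal.span (s.erase (e i : R) : Set R) := by
    have h1 : c i * (e i : R) = -∑ j ∈ Finset.univ.erase i, c j * (e j : R) := by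
      rw [eq_neg_iff_add_eq_zero, ← hc]
      exact Finset.add_sum_erase _ (fun j => c j * (e j : R)) (Finset.mem_univ i)
    rw [← Ideal.unit_mul_mem_iff_mem _ hi, h1]
    refine neg_mem (sum_mem fun j hj => Ideal.mul_mem_left _ _ (Ideal.subset_span ?_))
    simp only [Finset.coe_erase, Set.mem_sdiff, Finset.mem_coe, Set.mem_singleton_iff]
    exact ⟨(e j).2, fun h => Finset.ne_of_mem_erase hj (e.injective (Subtype.ext h))⟩
  have hspan' : Ideal.span (s.erase (e i : R) : Set R) = J := by
    refine le_antisymm ?_ ?_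
    · exact (Ideal.span_mono (by simp)).trans hspan.le
    · refine hspan.ge.trans (Ideal.span_le.2 fun t ht => ?_)
      by_cases hte : t = e i
      · rw [hte]; exact hmem
      · exact Ideal.subset_span (by simp [hte, Finset.mem_coe.1 ht])
  have hle := Submodule.spanFinrank_span_le_ncard_of_finite (R := R)
    (s.erase (e i : R)).finite_toSet
  rw [Set.ncard_coe_finset, Finset.card_erase_of_mem (e i).2, hs] at hle
  change (Ideal.span _).spanFinrank ≤ _ at hle
  rw [hspan'] at hle
  have := i.pos
  omega

end GeneratorBounds

/-! ### Perturbing the last entry of a tuple -/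

section Perturbation

variable {R : Type u} [CommRing R]

/-- The tuple `(b₀, …, b_{k-1}, b_k + p b_{k+1})`. -/
def perturbLast {k : ℕ} (b : Fin (k + 2) → R) (p : R) (i : Fin (k + 1)) : R :=
  b i.castSucc + Pi.single (M := fun _ => R) (Fin.last k) (p * b (Fin.last _)) i

theorem sum_mul_perturbLast {k : ℕ} (b : Fin (k + 2) → R) (p : R) (c : Fin (k + 1) → R) :
    ∑ i, c i * perturbLast b p i =
      ∑ i, Fin.snoc (α := fun _ => R) c (c (Fin.last k) * p) i * b i := by
  rw [Fin.sum_univ_castSucc (n := k + 1)]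
  simp [perturbLast, mul_add, Finset.sum_add_distrib, Pi.single_apply, mul_assoc]

end Perturbation

/-! ### Independent tuples modulo an ideal and recovery of the parameter -/

section Construction

open IsLocalRing

variable {R : Type u} [CommRing R] [IsLocalRing R]

theorem exists_independent_of_forall_lt_spanFinrank {A : Type u} [CommRing A] [IsLocalRing A]
    [IsNoetherianRing A] (h : ∀ n : ℕ, ∃ J : Ideal A, n < J.spanFinrank) (r : ℕ) :
    ∃ a : Fin r → A, ∀ c : Fin r → A, ∑ i, c i * a i = 0 → ∀ i, c i ∈ maximalIdeal A := by
  obtain ⟨J, hJ⟩ := h r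
  obtain ⟨a, ha⟩ := exists_generators_of_spanFinrank J
  let e := Fin.castLE hJ.le
  have he : Function.Injective e := Fin.castLE_injective hJ.le
  refine ⟨a ∘ e, fun c hc i => ?_⟩
  -- A relation among `r` of the generators is padded by zeros to one among all of them.
  rw [← he.extend_apply c 0 i]
  refine ha _ ?_ (e i)
  rw [← hc]
  refine (Finset.sum_of_injOn e he.injOn (by simp) (fun j _ hj => ?_) fun j _ => ?_).symm
  · rw [Function.extend_apply' _ _ _ (by simpa using hj)]
    simp
  · rw [he.extend_apply]; rfl

theorem exists_lift_independent {𝔞 : Ideal R} [IsLocalRing (R ⧸ 𝔞)] {r : ℕ} {a : Fin r → R ⧸ 𝔞}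
    (ha : ∀ c : Fin r → R ⧸ 𝔞, ∑ i, c i * a i = 0 → ∀ i, c i ∈ maximalIdeal (R ⧸ 𝔞)) :
    ∃ b : Fin r → R, ∀ c : Fin r → R, ∑ i, c i * b i ∈ 𝔞 → ∀ i, c i ∈ maximalIdeal R := by
  choose b hb using fun i => Ideal.Quotient.mk_surjective (a i)
  refine ⟨b, fun c hc i hi => ?_⟩
  refine ha (fun i => Ideal.Quotient.mk 𝔞 (c i)) ?_ i (hi.map (Ideal.Quotient.mk 𝔞))
  rw [← Ideal.Quotient.eq_zero_iff_mem.2 hc, map_sum]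
  exact Finset.sum_congr rfl fun i _ => by rw [map_mul, hb]

variable {k : ℕ} {b : Fin (k + 2) → R} {𝔞 : Ideal R}

theorem perturbLast_independent
    (hb : ∀ c : Fin (k + 2) → R, ∑ i, c i * b i ∈ 𝔞 → ∀ i, c i ∈ maximalIdeal R) (p : R)
    (c : Fin (k + 1) → R) (hc : ∑ i, c i * perturbLast b p i ∈ 𝔞) (i : Fin (k + 1)) :
    c i ∈ maximalIdeal R := by
  rw [sum_mul_perturbLast] at hc
  simpa using hb _ hc i.castSucc

theorem residue_eq_of_perturbLast_mem
    (hb : ∀ c : Fin (k + 2) → R, ∑ i, c i * b i ∈ 𝔞 → ∀ i, c i ∈ maximalIdeal R) {p q : R}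
    (h : perturbLast b p (Fin.last k) ∈ 𝔞 ⊔ Ideal.span (Set.range (perturbLast b q))) :
    residue R p = residue R q := by
  obtain ⟨z, hz, w, hw, hzw⟩ := Submodule.mem_sup.1 h
  obtain ⟨c, rfl⟩ := (Submodule.mem_span_range_iff_exists_fun R).1 hw
  have hp := sum_mul_perturbLast b p (Pi.single (Fin.last k) 1)
  have hq := sum_mul_perturbLast b q c
  have hlast : ∑ i, (Pi.single (M := fun _ => R) (Fin.last k) 1 : Fin (k + 1) → R) i *
      perturbLast b p i = perturbLast b p (Fin.last k) := by simp [Pi.single_apply]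
  rw [hlast] at hp
  -- Expanding both sides in the original `b` gives a relation modulo `𝔞`. Its last two
  -- coefficients, `1 - c_k` and `p - c_k q`, are then in the maximal ideal, hence so is `p - q`.
  have key := hb (Fin.snoc (α := fun _ => R) (Pi.single (Fin.last k) 1)
      ((Pi.single (M := fun _ => R) (Fin.last k) 1 : Fin (k + 1) → R) (Fin.last k) * p) -
        Fin.snoc (α := fun _ => R) c (c (Fin.last k) * q)) (by
    simp only [Pi.sub_apply, sub_mul, Finset.sum_sub_distrib]
    rw [← hp, ← hq, ← hzw]
    simpa using hz)
  have h1 := key (Fin.last k).castSucc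
  have h2 := key (Fin.last _)
  simp only [Pi.sub_apply, Fin.snoc_castSucc, Fin.snoc_last, Pi.single_eq_same, one_mul] at h1 h2
  refine Ideal.Quotient.eq.2 ?_
  have h3 : p - q = (p - c (Fin.last k) * q) - q * (1 - c (Fin.last k)) := by ring
  rw [h3]
  exact sub_mem h2 (Ideal.mul_mem_left _ _ h1)

end Construction

/-! ### The main theorem -/

theorem corollary2219 {R : Type u} [CommRing R] [IsLocalRing R] [IsNoetherianRing R]
    (x y : R) (hxy : IsExactZerodivisorPair x y)
    (hG : IsGRegular (R ⧸ Ideal.span {x}))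
    (hI : ∃ I : Ideal R, I ≠ ⊤ ∧
      2 ≤ (I.map (Ideal.Quotient.mk (Ideal.span {x, y}))).height) :
    exactPairRank x y = ⊤ ∧
    (∀ r : ℕ, ∃ M : ModuleCat.{u} R,
      IsExtensionModule x y r M ∧ CategoryTheory.Indecomposable M) ∧
    (∀ r : ℕ, 1 ≤ r → ∃ M : R → ModuleCat.{u} R,
      (∀ a : R, IsExtensionModule x y r (M a) ∧ CategoryTheory.Indecomposable (M a)) ∧
      (∀ p q : R, Nonempty (M p ≃ₗ[R] M q) →
        IsLocalRing.residue R p = IsLocalRing.residue R q)) := by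
  have hle : Ideal.span {x, y} ≤ IsLocalRing.maximalIdeal R := by
    rw [Ideal.span_le, Set.insert_subset_iff, Set.singleton_subset_iff]
    exact ⟨hxy.left_mem, hxy.right_mem⟩
  have : Nontrivial (R ⧸ Ideal.span {x, y}) := Ideal.Quotient.nontrivial_iff.2 fun h =>
    (IsLocalRing.maximalIdeal.isMaximal R).ne_top (top_le_iff.1 (h ▸ hle))
  have : IsLocalRing (R ⧸ Ideal.span {x, y}) :=
    .of_surjective' (Ideal.Quotient.mk _) Ideal.Quotient.mk_surjective
  obtain ⟨I, hI1, hI2⟩ := hI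
  have hImap : I.map (Ideal.Quotient.mk (Ideal.span {x, y})) ≠ ⊤ := by
    intro h
    have h1 : I ≤ IsLocalRing.maximalIdeal R := IsLocalRing.le_maximalIdeal hI1
    have h2 := congrArg (Ideal.comap (Ideal.Quotient.mk (Ideal.span {x, y}))) h
    rw [Ideal.comap_map_of_surjective' _ Ideal.Quotient.mk_surjective, Ideal.mk_ker,
      Ideal.comap_top] at h2
    exact (IsLocalRing.maximalIdeal.isMaximal R).ne_top (top_le_iff.1 (h2 ▸ sup_le h1 hle))
  have hgen := exists_lt_spanFinrank_of_two_le_height hImap hI2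
  have hind : ∀ r : ℕ, ∃ b : Fin r → R, ∀ c : Fin r → R,
      ∑ i, c i * b i ∈ Ideal.span {x, y} → ∀ i, c i ∈ IsLocalRing.maximalIdeal R := fun r => by
    obtain ⟨a, ha⟩ := exists_independent_of_forall_lt_spanFinrank hgen r
    exact exists_lift_independent ha
  refine ⟨?_, fun r => ?_, fun r hr => ?_⟩
  · refine iSup_eq_top.2 fun n hn => ?_
    lift n to ℕ using hn.ne
    obtain ⟨J, hJ⟩ := hgen n
    refine ⟨J.comap (Ideal.Quotient.mk _), ?_⟩
    rw [Ideal.map_comap_of_surjective _ Ideal.Quotient.mk_surjective]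
    exact_mod_cast hJ
  · obtain ⟨b, hb⟩ := hind r
    exact ⟨ModuleCat.of R (ExtensionModule x y b), ExtensionModule.isExtensionModule b hxy,
      ExtensionModule.indecomposable b hxy hG hb⟩
  · obtain ⟨k, rfl⟩ := Nat.exists_eq_add_of_le' hr
    -- The rank is `k + 1`; the one extra independent element is the direction of perturbation.
    obtain ⟨b, hb⟩ := hind (k + 2)
    refine ⟨fun p => ModuleCat.of R (ExtensionModule x y (perturbLast b p)), fun p =>
      ⟨ExtensionModule.isExtensionModule _ hxy,
        ExtensionModule.indecomposable _ hxy hG (perturbLast_independent hb p)⟩, ?_⟩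
    rintro p q ⟨e⟩
    refine residue_eq_of_perturbLast_mem hb ?_
    rw [← Ideal.span_union]
    exact ExtensionModule.mem_of_linearEquiv e _
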